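/- Let $K$ be a field of characteristic $0$ and let $A_1$ be the first Weyl algebra over $K$, i.e. the associative unital $K$-algebra generated by $p,q$ subject to the relation $[p,q]=pq-qp=1$. For $t\in\mathbb{Z}$ let $D_t$ be the $K$-linear span of the monomials $p^iq^s$ with $i,s\in\mathbb{Z}_{\ge 0}$ and $s-i=t$, so that $A_1=\bigoplus_{t\in\mathbb{Z}}D_t$, and let $D_{\ge -1}=\bigoplus_{t\ge -1}D_t$. If $z,w\in A_1$ satisfy $[z,w]=zw-wz=1$ and $z\in D_{\ge -1}$, then $z$ and $w$ generate $A_1$ as a $K$-algebra. -/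

import Mathlib

/-- The defining relation `p q = q p + 1` of the first Weyl algebra, on the free associative
`K`-algebra on two letters; the letter `0` is `p` and the letter `1` is `q`. -/
inductive WeylAlgebra.Rel (K : Type*) [Field K] :
    FreeAlgebra K (Fin 2) → FreeAlgebra K (Fin 2) → Prop
  | comm : WeylAlgebra.Rel K
      (FreeAlgebra.ι K (0 : Fin 2) * FreeAlgebra.ι K (1 : Fin 2))
      (FreeAlgebra.ι K (1 : Fin 2) * FreeAlgebra.ι K (0 : Fin 2) + 1)

/-- The first Weyl algebra `A₁` over `K`: the associative unital `K`-algebra generated by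
`p`, `q` subject to the single relation `p q - q p = 1`. -/
def WeylAlgebra (K : Type*) [Field K] : Type _ :=
  RingQuot (WeylAlgebra.Rel K)

namespace WeylAlgebra

instance instRing (K : Type*) [Field K] : Ring (WeylAlgebra K) :=
  inferInstanceAs (Ring (RingQuot (WeylAlgebra.Rel K)))

instance instAlgebra (K : Type*) [Field K] : Algebra K (WeylAlgebra K) :=
  inferInstanceAs (Algebra K (RingQuot (WeylAlgebra.Rel K)))

/-- The canonical projection from the free algebra on two letters. -/
def mk (K : Type*) [Field K] : FreeAlgebra K (Fin 2) →ₐ[K] WeylAlgebra K :=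
  RingQuot.mkAlgHom K (WeylAlgebra.Rel K)

/-- The generator `p`. -/
def p (K : Type*) [Field K] : WeylAlgebra K := mk K (FreeAlgebra.ι K (0 : Fin 2))

/-- The generator `q`. -/
def q (K : Type*) [Field K] : WeylAlgebra K := mk K (FreeAlgebra.ι K (1 : Fin 2))

/-- `D t` is the `K`-linear span of the monomials `p ^ i * q ^ s` with `s - i = t`
(a difference of integers). -/
def D (K : Type*) [Field K] (t : ℤ) : Submodule K (WeylAlgebra K) :=
  Submodule.span K {x | ∃ i s : ℕ, (s : ℤ) - (i : ℤ) = t ∧ x = p K ^ i * q K ^ s}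

/-- `Dge n` is the sum of all `D t` with `t ≥ n`. -/
def Dge (K : Type*) [Field K] (n : ℤ) : Submodule K (WeylAlgebra K) :=
  ⨆ t : ℤ, ⨆ _ : n ≤ t, D K t

end WeylAlgebra

/-! Put X = pq. Sending q to T and p to X T⁻¹ embeds A₁ in the skew Laurent ring K[X][T, T⁻¹], so an
element is a family of polynomials `comp t x`. For t < 0 a nonzero component is divisible by a
Pochhammer polynomial of degree -t.

The engine is `coeff_bracket`: if f, g have degrees m, n, then [f T^s, g T^t] has coefficient (t m -
s n) lc(f) lc(g) in X-degree m + n - 1. So if [x, y] = 1, a dominant pair of components with t m ≠ s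
n must satisfy s + t = 0 and m + n = 1 (`degrees_of_commutator_eq_one`).

If z lives in degrees ≥ 1, lowest components force w into degrees ≥ -1, and a Newton polygon
argument (`comp_eq_zero_of_two_le`) leaves z = a q. Then a w + p centralizes q, hence lies in K[q],
and p is recovered. If z lives in degrees ≥ 0, its degree-0 component is a constant, which can be
subtracted. If z starts in degree -1, subtracting multiples of powers of z from w pushes w into
degrees ≥ 1, and the pair (w, -z) falls under the first case. -/

namespace WeylAlgebra

open Polynomial

/-! ### Embedding into skew Laurent polynomials; homogeneous components. -/

section SkewLaurent

variable (K : Type*) [Field K]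

/-- The integers act on `K[X]` by the translations `f(X) ↦ f(X - n)`. -/
noncomputable instance translationAction :
    MulSemiringAction (Multiplicative ℤ) K[X] where
  smul a f := taylor (-((Multiplicative.toAdd a : ℤ) : K)) f
  one_smul f := by
    change taylor (-(((0 : ℤ)) : K)) f = f
    simp
  mul_smul a b f := by
    change taylor (-(((Multiplicative.toAdd a + Multiplicative.toAdd b : ℤ)) : K)) f =
      taylor _ (taylor _ f)
    rw [taylor_taylor]
    push_cast
    congr 1
    ring_nf
  smul_zero a := map_zero _
  smul_add a f g := map_add _ f g
  smul_one a := by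
    change taylor _ _ = _
    simp
  smul_mul a f g := taylor_mul _ f g

/-- The ring of skew Laurent polynomials `K[X][T, T⁻¹]` with `T f(X) = f(X - 1) T`. -/
abbrev SkewLaurent : Type _ := SkewMonoidAlgebra K[X] (Multiplicative ℤ)

variable {K}

theorem ofAdd_smul (n : ℤ) (f : K[X]) :
    Multiplicative.ofAdd n • f = taylor (-(n : K)) f := rfl

instance translationAction_smulCommClass : SMulCommClass (Multiplicative ℤ) K K[X] where
  smul_comm a c f := map_smul (taylor (-((Multiplicative.toAdd a : ℤ) : K))) c f

/-- The monomial `f T ^ n`. -/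
noncomputable def SkewLaurent.monomial (n : ℤ) (f : K[X]) : SkewLaurent K :=
  SkewMonoidAlgebra.single (Multiplicative.ofAdd n) f

theorem SkewLaurent.monomial_mul_monomial (m n : ℤ) (f g : K[X]) :
    SkewLaurent.monomial m f * SkewLaurent.monomial n g =
      SkewLaurent.monomial (m + n) (f * taylor (-(m : K)) g) := by
  simp only [SkewLaurent.monomial, SkewMonoidAlgebra.single_mul_single, ofAdd_smul]
  rfl

theorem SkewLaurent.one_eq : (1 : SkewLaurent K) = SkewLaurent.monomial 0 1 := rfl

variable (K) in
/-- The homomorphism from the Weyl algebra to skew Laurent polynomials with `q ↦ T` and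
`p ↦ X T⁻¹`. -/
noncomputable def toSkewLaurent : WeylAlgebra K →ₐ[K] SkewLaurent K :=
  RingQuot.liftAlgHom K ⟨FreeAlgebra.lift K
    ![SkewLaurent.monomial (-1) X, SkewLaurent.monomial 1 1], by
      intro x y h
      cases h
      simp only [map_mul, map_add, map_one, FreeAlgebra.lift_ι_apply, Matrix.cons_val_zero,
        Matrix.cons_val_one, SkewLaurent.monomial_mul_monomial, SkewLaurent.one_eq]
      simp only [SkewLaurent.monomial]
      simp⟩

@[simp]
theorem toSkewLaurent_p : toSkewLaurent K (p K) = SkewLaurent.monomial (-1) X := by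
  have h : toSkewLaurent K (p K) = FreeAlgebra.lift K
      ![SkewLaurent.monomial (-1) X, SkewLaurent.monomial 1 1] (FreeAlgebra.ι K 0) :=
    RingQuot.liftAlgHom_mkAlgHom_apply _ _ _ _
  rw [h, FreeAlgebra.lift_ι_apply]
  rfl

@[simp]
theorem toSkewLaurent_q : toSkewLaurent K (q K) = SkewLaurent.monomial 1 1 := by
  have h : toSkewLaurent K (q K) = FreeAlgebra.lift K
      ![SkewLaurent.monomial (-1) X, SkewLaurent.monomial 1 1] (FreeAlgebra.ι K 1) :=
    RingQuot.liftAlgHom_mkAlgHom_apply _ _ _ _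
  rw [h, FreeAlgebra.lift_ι_apply]
  rfl

theorem SkewLaurent.monomial_one_pow (s : ℕ) :
    (SkewLaurent.monomial 1 1 : SkewLaurent K) ^ s = SkewLaurent.monomial s 1 := by
  induction s with
  | zero => rfl
  | succ s ih =>
    rw [pow_succ, ih, SkewLaurent.monomial_mul_monomial]
    simp

theorem SkewLaurent.monomial_neg_one_pow (i : ℕ) :
    (SkewLaurent.monomial (-1) X : SkewLaurent K) ^ i =
      SkewLaurent.monomial (-i) (ascPochhammer K i) := by
  induction i with
  | zero => simp [SkewLaurent.one_eq]
  | succ i ih =>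
    rw [pow_succ, ih, SkewLaurent.monomial_mul_monomial, ascPochhammer_succ_right]
    simp [add_comm]

theorem p_mul_q : p K * q K = q K * p K + 1 := by
  have h := RingQuot.mkAlgHom_rel K (Rel.comm (K := K))
  simp only [map_mul, map_add, map_one] at h
  exact h

/-- The component of degree `t` of an element of the Weyl algebra, as a polynomial in `p q`:
the coefficient of `T ^ t` in the skew Laurent expansion. -/
noncomputable def comp (t : ℤ) : WeylAlgebra K →ₗ[K] K[X] where
  toFun x := (toSkewLaurent K x).coeff (Multiplicative.ofAdd t)
  map_add' x y := by simp
  map_smul' c x := by simp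

theorem comp_apply (t : ℤ) (x : WeylAlgebra K) :
    comp t x = (toSkewLaurent K x).coeff (Multiplicative.ofAdd t) := rfl

theorem SkewLaurent.coeff_monomial (n t : ℤ) (f : K[X]) :
    (SkewLaurent.monomial n f).coeff (Multiplicative.ofAdd t) = if n = t then f else 0 := by
  classical
  rw [SkewLaurent.monomial, SkewMonoidAlgebra.coeff_single_apply]
  rfl

theorem comp_q_pow (s : ℕ) (t : ℤ) :
    comp t (q K ^ s) = if (s : ℤ) = t then 1 else 0 := by
  rw [comp_apply, map_pow, toSkewLaurent_q, SkewLaurent.monomial_one_pow,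
    SkewLaurent.coeff_monomial]

theorem comp_q (t : ℤ) : comp t (q K) = if 1 = t then 1 else 0 := by
  simpa using comp_q_pow (K := K) 1 t

theorem comp_one (t : ℤ) : comp t (1 : WeylAlgebra K) = if 0 = t then 1 else 0 := by
  simpa using comp_q_pow (K := K) 0 t

theorem comp_p_pow (i : ℕ) (t : ℤ) :
    comp t (p K ^ i) = if -(i : ℤ) = t then ascPochhammer K i else 0 := by
  rw [comp_apply, map_pow, toSkewLaurent_p, SkewLaurent.monomial_neg_one_pow,
    SkewLaurent.coeff_monomial]

theorem comp_p_pow_mul_q_pow (i s : ℕ) (t : ℤ) (h : (s : ℤ) - i ≠ t) :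
    comp t (p K ^ i * q K ^ s) = 0 := by
  rw [comp_apply, map_mul, map_pow, map_pow, toSkewLaurent_p, toSkewLaurent_q,
    SkewLaurent.monomial_neg_one_pow, SkewLaurent.monomial_one_pow,
    SkewLaurent.monomial_mul_monomial, SkewLaurent.coeff_monomial, if_neg]
  omega

theorem comp_eq_zero_of_mem_Dge {n : ℤ} {x : WeylAlgebra K} (hx : x ∈ Dge K n) {t : ℤ}
    (ht : t < n) : comp t x = 0 := by
  have h : Dge K n ≤ LinearMap.ker (comp (K := K) t) := by
    refine iSup₂_le fun r hr => Submodule.span_le.2 ?_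
    rintro _ ⟨i, s, his, rfl⟩
    exact comp_p_pow_mul_q_pow i s t (by omega)
  exact h hx

/-- The degrees in which an element of the Weyl algebra has a nonzero component. -/
noncomputable def degrees (x : WeylAlgebra K) : Finset ℤ :=
  (toSkewLaurent K x).support.map Multiplicative.toAdd.toEmbedding

theorem mem_degrees {x : WeylAlgebra K} {t : ℤ} : t ∈ degrees x ↔ comp t x ≠ 0 := by
  rw [degrees, Finset.mem_map_equiv, SkewMonoidAlgebra.mem_support_iff]
  rfl

theorem comp_mul (x y : WeylAlgebra K) (n : ℤ) :
    comp n (x * y) = ∑ s ∈ degrees x, comp s x * taylor (-(s : K)) (comp (n - s) y) := by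
  rw [comp_apply, map_mul, SkewMonoidAlgebra.coeff_mul_left, SkewMonoidAlgebra.sum_def',
    degrees, Finset.sum_map]
  refine Finset.sum_congr rfl fun s _ => ?_
  rw [comp_apply, comp_apply, ← ofAdd_smul]
  congr 3
  exact congrArg Multiplicative.ofAdd (neg_add_eq_sub (Multiplicative.toAdd s) n)

theorem comp_mul' (x y : WeylAlgebra K) (n : ℤ) :
    comp n (y * x) = ∑ s ∈ degrees x, comp (n - s) y * taylor (-((n - s : ℤ) : K)) (comp s x) := by
  rw [comp_apply, map_mul, SkewMonoidAlgebra.coeff_mul_right, SkewMonoidAlgebra.sum_def',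
    degrees, Finset.sum_map]
  refine Finset.sum_congr rfl fun s _ => ?_
  rw [comp_apply, comp_apply, ← ofAdd_smul]
  congr 2

/-- The homogeneous commutator polynomial: `[f T ^ s, g T ^ t] = bracket s t f g T ^ (s + t)`. -/
noncomputable def bracket (s t : ℤ) (f g : K[X]) : K[X] :=
  f * taylor (-(s : K)) g - g * taylor (-(t : K)) f

theorem comp_commutator (x y : WeylAlgebra K) (n : ℤ) :
    comp n (x * y - y * x) =
      ∑ s ∈ degrees x, bracket s (n - s) (comp s x) (comp (n - s) y) := by
  rw [map_sub, comp_mul, comp_mul' x y, ← Finset.sum_sub_distrib]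
  rfl

end SkewLaurent

/-! ### Normal form over K[pq] and faithfulness of components. -/

section NormalForm

variable {K : Type*} [Field K]

variable (K) in
/-- The basis element of degree `t` over `K[p q]`: `q ^ t` or `p ^ (-t)`. -/
noncomputable def gen (t : ℤ) : WeylAlgebra K := p K ^ (-t).toNat * q K ^ t.toNat

variable (K) in
/-- The map `F ↦ ∑ F_t(p q) gen t`. -/
noncomputable def ofComponents : (ℤ →₀ K[X]) →ₗ[K] WeylAlgebra K :=
  Finsupp.lsum K fun t => (LinearMap.mulRight K (gen K t)).comp
    (aeval (p K * q K)).toLinearMap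

theorem ofComponents_single (t : ℤ) (f : K[X]) :
    ofComponents K (Finsupp.single t f) = aeval (p K * q K) f * gen K t := by
  simp [ofComponents]

theorem mem_range_ofComponents (t : ℤ) (f : K[X]) :
    aeval (p K * q K) f * gen K t ∈ LinearMap.range (ofComponents K) :=
  ⟨_, ofComponents_single t f⟩

theorem q_mul_aeval (f : K[X]) :
    q K * aeval (p K * q K) f = aeval (p K * q K) (taylor (-1) f) * q K := by
  induction f using Polynomial.induction_on with
  | C a => simp [Algebra.commutes]
  | add f g hf hg => simp only [map_add, mul_add, add_mul, hf, hg]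
  | monomial n a h =>
    have hX : q K * aeval (p K * q K) (X : K[X]) =
        aeval (p K * q K) (taylor (-1) X : K[X]) * q K := by
      simp [p_mul_q, mul_assoc, mul_add]
    rw [pow_succ, ← mul_assoc, map_mul, ← mul_assoc, h, mul_assoc, hX]
    simp only [taylor_mul, map_mul, mul_assoc]

theorem p_mul_aeval (f : K[X]) :
    p K * aeval (p K * q K) f = aeval (p K * q K) (taylor 1 f) * p K := by
  induction f using Polynomial.induction_on with
  | C a => simp [Algebra.commutes]
  | add f g hf hg => simp only [map_add, mul_add, add_mul, hf, hg]
  | monomial n a h =>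
    have hX : p K * aeval (p K * q K) (X : K[X]) =
        aeval (p K * q K) (taylor 1 X : K[X]) * p K := by
      have hp : p K * (p K * q K) = (p K * q K + 1) * p K := by
        conv_lhs => rw [p_mul_q]
        rw [mul_add, ← mul_assoc, add_mul, one_mul, mul_one]
      simpa using hp
    rw [pow_succ, ← mul_assoc, map_mul, ← mul_assoc, h, mul_assoc, hX]
    simp only [taylor_mul, map_mul, mul_assoc]

/-- In negative degree q meets a factor p, and q p = p q - 1 gives the factor X - 1. -/
theorem q_mul_gen (t : ℤ) :
    q K * gen K t = aeval (p K * q K) (if 0 ≤ t then 1 else X - 1 : K[X]) * gen K (t + 1) := by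
  split_ifs with h
  · lift t to ℕ using h
    have h1 : ((t : ℤ) + 1).toNat = t + 1 := by omega
    have h2 : (-((t : ℤ) + 1)).toNat = 0 := by omega
    rw [gen, gen, h1, h2]
    simp [pow_succ']
  · obtain ⟨m, rfl⟩ : ∃ m : ℕ, t = -(m + 1 : ℕ) := ⟨(-t - 1).toNat, by omega⟩
    have h1 : (-(-((m + 1 : ℕ) : ℤ))).toNat = m + 1 := by omega
    have h2 : (-((m + 1 : ℕ) : ℤ)).toNat = 0 := by omega
    have h3 : (-(-((m + 1 : ℕ) : ℤ) + 1)).toNat = m := by omega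
    have h4 : (-((m + 1 : ℕ) : ℤ) + 1).toNat = 0 := by omega
    rw [gen, gen, h1, h2, h3, h4]
    simp [p_mul_q, pow_succ', mul_assoc]

theorem p_mul_gen (t : ℤ) :
    p K * gen K t = aeval (p K * q K) (if t ≤ 0 then 1 else X : K[X]) * gen K (t - 1) := by
  split_ifs with h
  · obtain ⟨m, rfl⟩ : ∃ m : ℕ, t = -m := ⟨(-t).toNat, by omega⟩
    have h1 : (-(-(m : ℤ))).toNat = m := by omega
    have h2 : (-(m : ℤ)).toNat = 0 := by omega
    have h3 : (-(-(m : ℤ) - 1)).toNat = m + 1 := by omega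
    have h4 : (-(m : ℤ) - 1).toNat = 0 := by omega
    rw [gen, gen, h1, h2, h3, h4]
    simp [pow_succ']
  · obtain ⟨m, rfl⟩ : ∃ m : ℕ, t = (m + 1 : ℕ) := ⟨(t - 1).toNat, by omega⟩
    have h1 : (-((m + 1 : ℕ) : ℤ)).toNat = 0 := by omega
    have h2 : (((m + 1 : ℕ) : ℤ)).toNat = m + 1 := by omega
    have h3 : (-(((m + 1 : ℕ) : ℤ) - 1)).toNat = 0 := by omega
    have h4 : (((m + 1 : ℕ) : ℤ) - 1).toNat = m := by omega
    rw [gen, gen, h1, h2, h3, h4]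
    simp [pow_succ', mul_assoc]

theorem q_mul_mem_range {y : WeylAlgebra K} (hy : y ∈ LinearMap.range (ofComponents K)) :
    q K * y ∈ LinearMap.range (ofComponents K) := by
  obtain ⟨F, rfl⟩ := hy
  induction F using Finsupp.induction_linear with
  | zero => simp
  | add F G hF hG => rw [map_add, mul_add]; exact add_mem hF hG
  | single t f =>
    rw [ofComponents_single, ← mul_assoc, q_mul_aeval, mul_assoc, q_mul_gen, ← mul_assoc,
      ← map_mul]
    exact mem_range_ofComponents _ _

theorem p_mul_mem_range {y : WeylAlgebra K} (hy : y ∈ LinearMap.range (ofComponents K)) :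
    p K * y ∈ LinearMap.range (ofComponents K) := by
  obtain ⟨F, rfl⟩ := hy
  induction F using Finsupp.induction_linear with
  | zero => simp
  | add F G hF hG => rw [map_add, mul_add]; exact add_mem hF hG
  | single t f =>
    rw [ofComponents_single, ← mul_assoc, p_mul_aeval, mul_assoc, p_mul_gen, ← mul_assoc,
      ← map_mul]
    exact mem_range_ofComponents _ _

theorem mk_surjective : Function.Surjective (mk K) := RingQuot.mkAlgHom_surjective K (Rel K)

variable (K) in
-- The range contains 1 and is stable under left multiplication by p and q, hence by everything.
theorem ofComponents_surjective : Function.Surjective (ofComponents K) := by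
  have h : ∀ a : FreeAlgebra K (Fin 2), ∀ y ∈ LinearMap.range (ofComponents K),
      mk K a * y ∈ LinearMap.range (ofComponents K) := by
    intro a
    induction a using FreeAlgebra.induction with
    | grade0 r =>
      intro y hy
      rw [AlgHom.commutes, ← Algebra.smul_def]
      exact Submodule.smul_mem _ _ hy
    | grade1 i =>
      intro y hy
      fin_cases i
      · exact p_mul_mem_range hy
      · exact q_mul_mem_range hy
    | mul a b ha hb =>
      intro y hy
      rw [map_mul, mul_assoc]
      exact ha _ (hb _ hy)
    | add a b ha hb =>
      intro y hy
      rw [map_add, add_mul]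
      exact add_mem (ha _ hy) (hb _ hy)
  intro x
  obtain ⟨a, rfl⟩ := mk_surjective x
  simpa using h a 1 ⟨Finsupp.single 0 1, by simp [ofComponents_single, gen]⟩

theorem toSkewLaurent_aeval (f : K[X]) :
    toSkewLaurent K (aeval (p K * q K) f) = SkewLaurent.monomial 0 f := by
  induction f using Polynomial.induction_on with
  | C a =>
    rw [aeval_C, AlgHom.commutes]
    rfl
  | add f g hf hg =>
    rw [map_add, map_add, hf, hg, SkewLaurent.monomial, SkewLaurent.monomial,
      SkewLaurent.monomial, SkewMonoidAlgebra.single_add]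
  | monomial n a h =>
    rw [pow_succ, ← mul_assoc, map_mul, map_mul, h, aeval_X, map_mul, toSkewLaurent_p,
      toSkewLaurent_q, SkewLaurent.monomial_mul_monomial, SkewLaurent.monomial_mul_monomial]
    simp

theorem comp_aeval_mul (f : K[X]) (x : WeylAlgebra K) (t : ℤ) :
    comp t (aeval (p K * q K) f * x) = f * comp t x := by
  rw [comp_apply, map_mul, toSkewLaurent_aeval, SkewLaurent.monomial,
    SkewMonoidAlgebra.coeff_single_mul]
  simp [comp_apply]

theorem comp_gen (s t : ℤ) :
    comp t (gen K s) = if s = t then ascPochhammer K (-t).toNat else 0 := by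
  rcases le_total 0 s with h | h
  · have h1 : (-s).toNat = 0 := by omega
    rw [gen, h1, pow_zero, one_mul, comp_q_pow, Int.toNat_of_nonneg h]
    split_ifs with hst
    · rw [← hst, h1, ascPochhammer_zero]
    · rfl
  · have h1 : s.toNat = 0 := by omega
    rw [gen, h1, pow_zero, mul_one, comp_p_pow, Int.toNat_of_nonneg (by omega), neg_neg]
    split_ifs with hst
    · rw [hst]
    · rfl

theorem comp_ofComponents (F : ℤ →₀ K[X]) (t : ℤ) :
    comp t (ofComponents K F) = F t * ascPochhammer K (-t).toNat := by
  induction F using Finsupp.induction_linear with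
  | zero => simp
  | add F G hF hG => rw [map_add, map_add, hF, hG, Finsupp.add_apply, add_mul]
  | single s f =>
    rw [ofComponents_single, comp_aeval_mul, comp_gen, Finsupp.single_apply]
    split_ifs <;> simp

/-- Components recover the normal form up to nonzero Pochhammer factors, which cancel in the domain
K[X]. -/
theorem ext_comp {x y : WeylAlgebra K} (h : ∀ t, comp t x = comp t y) : x = y := by
  obtain ⟨F, rfl⟩ := ofComponents_surjective K x
  obtain ⟨G, rfl⟩ := ofComponents_surjective K y
  congr 1
  ext1 t
  have ht := h t
  rw [comp_ofComponents, comp_ofComponents] at ht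
  exact mul_right_cancel₀ (monic_ascPochhammer K _).ne_zero ht

/-- The Pochhammer factor contributed by p^(-t) already has degree -t. This is where A₁ differs from
the full skew Laurent ring. -/
theorem neg_le_natDegree_comp {x : WeylAlgebra K} {t : ℤ} (h : comp t x ≠ 0) :
    -t ≤ (comp t x).natDegree := by
  obtain ⟨F, rfl⟩ := ofComponents_surjective K x
  rw [comp_ofComponents] at h ⊢
  rw [natDegree_mul (left_ne_zero_of_mul h) (right_ne_zero_of_mul h), ascPochhammer_natDegree]
  omega

theorem adjoin_p_q : Algebra.adjoin K {p K, q K} = ⊤ := by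
  rw [Algebra.eq_top_iff]
  intro x
  obtain ⟨a, rfl⟩ := mk_surjective x
  induction a using FreeAlgebra.induction with
  | grade0 r => rw [AlgHom.commutes]; exact Subalgebra.algebraMap_mem _ r
  | grade1 i =>
    apply Algebra.subset_adjoin
    fin_cases i
    · exact Or.inl rfl
    · exact Or.inr rfl
  | mul a b ha hb => rw [map_mul]; exact mul_mem ha hb
  | add a b ha hb => rw [map_add]; exact add_mem ha hb

end NormalForm

/-! ### Leading coefficients of commutators and dominant pairs. -/

section Bracket

variable {K : Type*} [Field K]

theorem natDegree_taylor_sub_self_lt {f : K[X]} {r : K} (h : taylor r f - f ≠ 0) :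
    (taylor r f - f).natDegree < f.natDegree := by
  by_contra! hle
  have h1 : (taylor r f - f).natDegree ≤ f.natDegree :=
    (natDegree_sub_le _ _).trans (by rw [natDegree_taylor, max_self])
  have h2 := le_antisymm h1 hle
  apply h
  rw [← leadingCoeff_eq_zero, leadingCoeff, h2, coeff_sub, coeff_taylor_natDegree,
    coeff_natDegree, sub_self]

theorem coeff_taylor_sub_self {f : K[X]} {r : K} {n : ℕ} (hf : f.natDegree ≤ n + 1) :
    (taylor r f - f).coeff n = (n + 1) * r * f.coeff (n + 1) := by
  rw [coeff_sub, taylor_coeff, hasseDeriv_apply, sum_over_range' _ (by simp) (n + 2) (by omega),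
    Finset.sum_range_succ, Finset.sum_range_succ, eval_add, eval_add, eval_finsetSum,
    Finset.sum_eq_zero]
  · simp
    ring
  · intro i hi
    rw [Nat.choose_eq_zero_of_lt (Finset.mem_range.1 hi)]
    simp

theorem coeff_mul_taylor_sub_self {f g : K[X]} {r : K} {m n N : ℕ} (hf : f.natDegree ≤ m)
    (hg : g.natDegree ≤ n) (hN : N + 1 = m + n) :
    (f * (taylor r g - g)).coeff N = n * r * (f.coeff m * g.coeff n) := by
  obtain _ | n := n
  · rw [eq_C_of_natDegree_le_zero hg]
    simp
  · have hΔ : (taylor r g - g).natDegree ≤ n := by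
      by_cases h : taylor r g - g = 0
      · simp [h]
      · have := natDegree_taylor_sub_self_lt h
        omega
    obtain rfl : N = m + n := by omega
    rw [coeff_mul_add_eq_of_natDegree_le hf hΔ, coeff_taylor_sub_self hg]
    push_cast
    ring

/-- The top coefficient of a homogeneous commutator. -/
theorem coeff_bracket {f g : K[X]} {s t : ℤ} {m n N : ℕ} (hf : f.natDegree ≤ m)
    (hg : g.natDegree ≤ n) (hN : N + 1 = m + n) :
    (bracket s t f g).coeff N = ((t * m - s * n : ℤ) : K) * (f.coeff m * g.coeff n) := by
  have h : bracket s t f g =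
      f * (taylor (-(s : K)) g - g) - g * (taylor (-(t : K)) f - f) := by
    rw [bracket]
    ring
  rw [h, coeff_sub, coeff_mul_taylor_sub_self hf hg hN,
    coeff_mul_taylor_sub_self hg hf (by omega)]
  push_cast
  ring

@[simp]
theorem bracket_zero_left (s t : ℤ) (g : K[X]) : bracket s t 0 g = 0 := by
  simp [bracket]

@[simp]
theorem bracket_zero_right (s t : ℤ) (f : K[X]) : bracket s t f 0 = 0 := by
  simp [bracket]

/-- A pair of components of `x` and `y` whose degrees dominate those of all other pairs with the
same total degree contributes the leading coefficient of the commutator. -/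
theorem coeff_comp_commutator {x y : WeylAlgebra K} {s t : ℤ} {N : ℕ}
    (hN : N + 1 = (comp s x).natDegree + (comp t y).natDegree)
    (hdom : ∀ s' t' : ℤ, s' + t' = s + t → s' ≠ s → comp s' x ≠ 0 → comp t' y ≠ 0 →
      (comp s' x).natDegree + (comp t' y).natDegree <
        (comp s x).natDegree + (comp t y).natDegree) :
    (comp (s + t) (x * y - y * x)).coeff N =
      ((t * (comp s x).natDegree - s * (comp t y).natDegree : ℤ) : K) *
        ((comp s x).leadingCoeff * (comp t y).leadingCoeff) := by
  rw [comp_commutator, finsetSum_coeff, Finset.sum_eq_single s]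
  · rw [add_sub_cancel_left, coeff_bracket le_rfl le_rfl hN]
    rfl
  · intro s' _ hs
    by_cases hx : comp s' x = 0
    · simp [hx]
    by_cases hy : comp (s + t - s') y = 0
    · simp [hy]
    have h := hdom s' (s + t - s') (by ring) hs hx hy
    rw [coeff_bracket (m := (comp s' x).natDegree) (n := N + 1 - (comp s' x).natDegree) le_rfl
      (by omega) (by omega),
      coeff_eq_zero_of_natDegree_lt (p := comp (s + t - s') y) (by omega)]
    simp
  · intro hs
    rw [mem_degrees, not_not] at hs
    simp [hs]

theorem exists_lowest {x : WeylAlgebra K} (hx : x ≠ 0) :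
    ∃ t, comp t x ≠ 0 ∧ ∀ t' < t, comp t' x = 0 := by
  have h : (degrees x).Nonempty := by
    by_contra h
    rw [Finset.not_nonempty_iff_eq_empty] at h
    refine hx (ext_comp fun t => ?_)
    rw [map_zero]
    by_contra ht
    rw [← ne_eq, ← mem_degrees, h] at ht
    exact absurd ht (Finset.notMem_empty t)
  refine ⟨(degrees x).min' h, mem_degrees.1 (Finset.min'_mem _ _), fun t' ht => ?_⟩
  by_contra h'
  exact absurd (Finset.min'_le _ _ (mem_degrees.2 h')) (not_le.2 ht)

/-- Breaking ties by the largest index is what later makes the dominant pair unique. -/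
theorem exists_max_image_then_max {S : Finset ℤ} (hS : S.Nonempty) (f : ℤ → ℚ) :
    ∃ s ∈ S, ∀ s' ∈ S, f s' < f s ∨ f s' = f s ∧ s' ≤ s := by
  obtain ⟨s, hs, h⟩ := S.exists_max_image (fun s => toLex (f s, s)) hS
  exact ⟨s, hs, fun s' hs' => (Prod.Lex.toLex_le_toLex).1 (h s' hs')⟩

variable [CharZero K]

theorem degrees_of_commutator_eq_one {x y : WeylAlgebra K} (hxy : x * y - y * x = 1) {s t : ℤ}
    (hx : comp s x ≠ 0) (hy : comp t y ≠ 0)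
    (hdom : ∀ s' t' : ℤ, s' + t' = s + t → s' ≠ s → comp s' x ≠ 0 → comp t' y ≠ 0 →
      (comp s' x).natDegree + (comp t' y).natDegree <
        (comp s x).natDegree + (comp t y).natDegree)
    (hne : t * (comp s x).natDegree - s * (comp t y).natDegree ≠ 0) :
    s + t = 0 ∧ (comp s x).natDegree + (comp t y).natDegree = 1 := by
  -- If both degrees were 0, the number in `hne` would vanish.
  obtain ⟨N, hN⟩ : ∃ N : ℕ, N + 1 = (comp s x).natDegree + (comp t y).natDegree := by
    refine ⟨(comp s x).natDegree + (comp t y).natDegree - 1, Nat.sub_add_cancel ?_⟩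
    by_contra! h
    apply hne
    rw [show (comp s x).natDegree = 0 by omega, show (comp t y).natDegree = 0 by omega]
    simp
  have h := coeff_comp_commutator hN hdom
  have h0 : (comp (s + t) (x * y - y * x)).coeff N ≠ 0 := by
    rw [h]
    exact mul_ne_zero (Int.cast_ne_zero.2 hne)
      (mul_ne_zero (leadingCoeff_ne_zero.2 hx) (leadingCoeff_ne_zero.2 hy))
  rw [hxy, comp_one] at h0
  split_ifs at h0 with hst
  · rw [coeff_one] at h0
    split_ifs at h0 with hN0
    · omega
    · exact absurd rfl h0
  · exact absurd rfl h0

theorem degrees_of_commutator_eq_one_of_lowest {x y : WeylAlgebra K} (hxy : x * y - y * x = 1)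
    {s t : ℤ} (hx : comp s x ≠ 0) (hy : comp t y ≠ 0) (hxs : ∀ s' < s, comp s' x = 0)
    (hyt : ∀ t' < t, comp t' y = 0)
    (hne : t * (comp s x).natDegree - s * (comp t y).natDegree ≠ 0) :
    s + t = 0 ∧ (comp s x).natDegree + (comp t y).natDegree = 1 := by
  refine degrees_of_commutator_eq_one hxy hx hy (fun s' t' hst hs hx' hy' => ?_) hne
  have h1 : ¬ s' < s := fun h => hx' (hxs _ h)
  have h2 : ¬ t' < t := fun h => hy' (hyt _ h)
  omega

end Bracket

/-! ### Reduction of pairs with commutator 1 to z = a q. -/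

section Generation

variable {K : Type*} [Field K]

theorem comp_commutator_lowest {x y : WeylAlgebra K} {s t : ℤ} (hxs : ∀ s' < s, comp s' x = 0)
    (hyt : ∀ t' < t, comp t' y = 0) :
    comp (s + t) (x * y - y * x) = bracket s t (comp s x) (comp t y) := by
  rw [comp_commutator, Finset.sum_eq_single s, add_sub_cancel_left]
  · intro s' _ hs
    rcases lt_or_gt_of_ne hs with h | h
    · simp [hxs s' h]
    · simp [hyt (s + t - s') (by omega)]
  · intro hs
    rw [mem_degrees, not_not] at hs
    simp [hs]

theorem comp_mul_lowest {x y : WeylAlgebra K} {s t : ℤ} (hxs : ∀ s' < s, comp s' x = 0)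
    (hyt : ∀ t' < t, comp t' y = 0) :
    comp (s + t) (x * y) = comp s x * taylor (-(s : K)) (comp t y) := by
  rw [comp_mul, Finset.sum_eq_single s, add_sub_cancel_left]
  · intro s' _ hs
    rcases lt_or_gt_of_ne hs with h | h
    · simp [hxs s' h]
    · simp [hyt (s + t - s') (by omega)]
  · intro hs
    rw [mem_degrees, not_not] at hs
    simp [hs]

theorem comp_mul_eq_zero {x y : WeylAlgebra K} {s t n : ℤ} (hxs : ∀ s' < s, comp s' x = 0)
    (hyt : ∀ t' < t, comp t' y = 0) (hn : n < s + t) : comp n (x * y) = 0 := by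
  rw [comp_mul]
  refine Finset.sum_eq_zero fun s' _ => ?_
  by_cases h : s' < s
  · simp [hxs s' h]
  · simp [hyt (n - s') (by omega)]

theorem comp_pow_eq_zero {x : WeylAlgebra K} {s : ℤ} (hxs : ∀ s' < s, comp s' x = 0) (k : ℕ) :
    ∀ n < k * s, comp n (x ^ k) = 0 := by
  induction k with
  | zero =>
    intro n hn
    rw [pow_zero, comp_one, if_neg]
    rintro rfl
    simp at hn
  | succ k ih =>
    intro n hn
    rw [pow_succ]
    refine comp_mul_eq_zero ih hxs ?_
    push_cast at hn
    linarith

theorem comp_pow_lowest {x : WeylAlgebra K} {s : ℤ} (hxs : ∀ s' < s, comp s' x = 0)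
    (hx : comp s x ≠ 0) (k : ℕ) :
    comp (k * s) (x ^ k) ≠ 0 ∧
      (comp (k * s) (x ^ k)).natDegree = k * (comp s x).natDegree := by
  induction k with
  | zero => simp [comp_one]
  | succ k ih =>
    have h : ((k + 1 : ℕ) : ℤ) * s = k * s + s := by push_cast; ring
    have hx' : taylor (-((k * s : ℤ) : K)) (comp s x) ≠ 0 := by rwa [ne_eq, taylor_eq_zero]
    rw [h, pow_succ, comp_mul_lowest (comp_pow_eq_zero hxs k) hxs]
    refine ⟨mul_ne_zero ih.1 hx', ?_⟩
    rw [natDegree_mul ih.1 hx', ih.2, natDegree_taylor]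
    ring

theorem comp_commutator_q (x : WeylAlgebra K) (t : ℤ) :
    comp (1 + t) (q K * x - x * q K) = taylor (-1) (comp t x) - comp t x := by
  rw [comp_commutator, Finset.sum_eq_single 1, add_sub_cancel_left, comp_q, if_pos rfl, bracket]
  · simp
  · intro s _ hs
    rw [comp_q, if_neg (Ne.symm hs), bracket_zero_left]
  · intro h
    rw [mem_degrees, not_not] at h
    rw [h, bracket_zero_left]

theorem adjoin_sub_smul_pow_le (z w : WeylAlgebra K) (b : K) (k : ℕ) :
    Algebra.adjoin K {z, w - b • z ^ k} ≤ Algebra.adjoin K {z, w} := by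
  have hz : z ∈ Algebra.adjoin K {z, w} := Algebra.subset_adjoin (Or.inl rfl)
  refine Algebra.adjoin_le ?_
  rintro x (rfl | rfl)
  · exact hz
  · exact sub_mem (Algebra.subset_adjoin (Or.inr rfl)) (Subalgebra.smul_mem _ (pow_mem hz k) b)

theorem exists_comp_eq_zero_of_lt (w : WeylAlgebra K) :
    ∃ k : ℕ, ∀ t < -(k : ℤ), comp t w = 0 := by
  by_cases hw : w = 0
  · exact ⟨0, fun t _ => by rw [hw, map_zero]⟩
  · obtain ⟨t, -, ht⟩ := exists_lowest hw
    exact ⟨(-t).toNat, fun t' ht' => ht t' (by omega)⟩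

variable [CharZero K]

theorem natDegree_eq_zero_of_taylor_eq_self {f : K[X]} {r : K} (hr : r ≠ 0)
    (h : taylor r f - f = 0) : f.natDegree = 0 := by
  by_contra hf
  obtain ⟨n, hn⟩ := Nat.exists_eq_succ_of_ne_zero hf
  have h1 := coeff_taylor_sub_self (r := r) hn.le
  rw [h, coeff_zero] at h1
  have h2 : f.coeff (n + 1) ≠ 0 := by
    rw [← Nat.succ_eq_add_one, ← hn]
    exact leadingCoeff_ne_zero.2 (by rintro rfl; simp at hf)
  exact mul_ne_zero (mul_ne_zero (Nat.cast_add_one_ne_zero n) hr) h2 h1.symm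

/-- The centralizer of `q` is `K[q]`. -/
theorem mem_adjoin_q_of_commute {x : WeylAlgebra K} (h : q K * x - x * q K = 0) :
    x ∈ Algebra.adjoin K {q K} := by
  -- Commuting with q makes each component invariant under X ↦ X - 1, hence constant in
  -- characteristic 0.
  have hdeg : ∀ t, (comp t x).natDegree = 0 := fun t =>
    natDegree_eq_zero_of_taylor_eq_self (r := -1) (by simp)
      (by rw [← comp_commutator_q, h, map_zero])
  have hneg : ∀ t < 0, comp t x = 0 := by
    intro t ht
    by_contra hx
    have := neg_le_natDegree_comp hx
    rw [hdeg] at this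
    simp at this
    omega
  have hx : x = ∑ t ∈ degrees x, (comp t x).coeff 0 • q K ^ t.toNat := by
    refine ext_comp fun n => ?_
    rw [map_sum, Finset.sum_eq_single n]
    · by_cases hn : n < 0
      · simp [hneg n hn]
      · rw [map_smul, comp_q_pow, Int.toNat_of_nonneg (not_lt.1 hn), if_pos rfl,
          smul_eq_C_mul, mul_one, ← eq_C_of_natDegree_eq_zero (hdeg n)]
    · intro t ht htn
      have h0 : 0 ≤ t := by
        by_contra h0
        exact mem_degrees.1 ht (hneg t (not_le.1 h0))
      rw [map_smul, comp_q_pow, Int.toNat_of_nonneg h0, if_neg htn, smul_zero]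
    · intro hn
      rw [mem_degrees, not_not] at hn
      simp [hn]
  rw [hx]
  exact sum_mem fun t _ => Subalgebra.smul_mem _
    (pow_mem (Algebra.subset_adjoin (Set.mem_singleton _)) _) _

theorem lowest_components {z w : WeylAlgebra K} (hzw : z * w - w * z = 1)
    (hz : ∀ s < 1, comp s z = 0) (hw : ∀ t < -1, comp t w = 0) :
    comp 1 z ≠ 0 ∧ comp (-1) w ≠ 0 ∧ (comp 1 z).natDegree = 0 ∧
      (comp (-1) w).natDegree = 1 := by
  have h := comp_commutator_lowest hz hw
  rw [hzw, comp_one, if_pos (by norm_num)] at h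
  have hz1 : comp 1 z ≠ 0 := by
    intro h0
    simp [h0] at h
  have hw1 : comp (-1) w ≠ 0 := by
    intro h0
    simp [h0] at h
  have h1 := neg_le_natDegree_comp hw1
  have h2 := (degrees_of_commutator_eq_one_of_lowest hzw hz1 hw1 hz hw (by omega)).2
  exact ⟨hz1, hw1, by omega, by omega⟩

/-- Newton polygon argument: a component of z in degree ≥ 2 would give a dominant pair with s + t ≥
1, whereas a nondegenerate dominant pair needs s + t = 0. -/
theorem comp_eq_zero_of_two_le {z w : WeylAlgebra K} (hzw : z * w - w * z = 1)
    (hz : ∀ s < 1, comp s z = 0) (hw : ∀ t < -1, comp t w = 0) :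
    ∀ s, 2 ≤ s → comp s z = 0 := by
  obtain ⟨hz1, hw1, hdz, hdw⟩ := lowest_components hzw hz hw
  by_contra! hne
  obtain ⟨s₀, hs₀, hzs₀⟩ := hne
  -- The steepest line through (1, 0), the point of the lowest component of z; its slope is l below.
  obtain ⟨s, hs, hsmax⟩ := exists_max_image_then_max
    (S := (degrees z).filter (2 ≤ ·)) ⟨s₀, Finset.mem_filter.2 ⟨mem_degrees.2 hzs₀, hs₀⟩⟩
    (fun s => (comp s z).natDegree / (s - 1))
  rw [Finset.mem_filter, mem_degrees] at hs
  obtain ⟨hzs, hs2⟩ := hs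
  have hs2' : (2 : ℚ) ≤ s := by exact_mod_cast hs2
  obtain ⟨l, hl⟩ : ∃ l : ℚ, l = (comp s z).natDegree / (s - 1) := ⟨_, rfl⟩
  have hl0 : 0 ≤ l := by
    rw [hl]
    exact div_nonneg (Nat.cast_nonneg _) (by linarith)
  have hm : ((comp s z).natDegree : ℚ) = l * (s - 1) := by
    rw [hl, div_mul_cancel₀]
    linarith
  have hzdom : ∀ s', comp s' z ≠ 0 → ((comp s' z).natDegree : ℚ) < l * (s' - 1) ∨
      ((comp s' z).natDegree : ℚ) = l * (s' - 1) ∧ s' ≤ s := by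
    intro s' hs'
    have h1 : ¬ s' < 1 := fun h => hs' (hz s' h)
    rcases eq_or_lt_of_le (not_lt.1 h1) with rfl | h2
    · right
      rw [hdz]
      exact ⟨by simp, by omega⟩
    · have h3 : (0 : ℚ) < s' - 1 := sub_pos.2 (by exact_mod_cast h2)
      have h4 := hsmax s' (Finset.mem_filter.2 ⟨mem_degrees.2 hs', by omega⟩)
      rwa [← hl, div_lt_iff₀ h3, div_eq_iff h3.ne'] at h4
  -- The supporting line of the same slope l for w.
  obtain ⟨t, ht, htmax⟩ := exists_max_image_then_max
    (S := degrees w) ⟨-1, mem_degrees.2 hw1⟩ (fun t => (comp t w).natDegree - l * t)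
  rw [mem_degrees] at ht
  have ht1 : -1 ≤ t := by
    by_contra h
    exact ht (hw t (not_le.1 h))
  have hn : 1 + l + l * t ≤ (comp t w).natDegree := by
    have h := htmax (-1) (mem_degrees.2 hw1)
    rw [hdw] at h
    push_cast at h
    rcases h with h | ⟨h, -⟩ <;> linarith
  have hst : (1 : ℚ) ≤ s + t := by exact_mod_cast (by omega : (1 : ℤ) ≤ s + t)
  have key := degrees_of_commutator_eq_one hzw hzs ht ?_ ?_
  · omega
  · intro s' t' hst' hs' hzs' hwt'
    have e : l * s' + l * t' = l * s + l * t := by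
      rw [← mul_add, ← mul_add]
      congr 1
      exact_mod_cast hst'
    have : ((comp s' z).natDegree : ℚ) + (comp t' w).natDegree <
        (comp s z).natDegree + (comp t w).natDegree := by
      rcases hzdom s' hzs' with h1 | ⟨h1, h1'⟩ <;>
        rcases htmax t' (mem_degrees.2 hwt') with h2 | ⟨h2, h2'⟩
      · linarith
      · linarith
      · linarith
      -- Equality on both lines gives s' ≤ s and t' ≤ t with equal sums, contradicting s' ≠ s.
      · omega
    exact_mod_cast this
  -- With m = l (s - 1) and n ≥ 1 + l + l t, one gets t m - s n ≤ -s - l (s + t) < 0.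
  · have h1 : (t : ℚ) * (comp s z).natDegree - s * (comp t w).natDegree < 0 := by
      have h2 : (s : ℚ) * (1 + l + l * t) ≤ s * (comp t w).natDegree :=
        mul_le_mul_of_nonneg_left hn (by linarith)
      have h3 : 0 ≤ l * (s + t) := mul_nonneg hl0 (by linarith)
      rw [hm]
      linarith
    have h2 : t * (comp s z).natDegree - s * (comp t w).natDegree < 0 := by exact_mod_cast h1
    exact h2.ne

theorem adjoin_eq_top_of_components {z w : WeylAlgebra K} (hzw : z * w - w * z = 1)
    (hz : ∀ s < 1, comp s z = 0) (hw : ∀ t < -1, comp t w = 0) :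
    Algebra.adjoin K {z, w} = ⊤ := by
  obtain ⟨hz1, -, hdz, -⟩ := lowest_components hzw hz hw
  have hz2 := comp_eq_zero_of_two_le hzw hz hw
  obtain ⟨a, ha⟩ : ∃ a, comp 1 z = C a := ⟨_, eq_C_of_natDegree_eq_zero hdz⟩
  have ha0 : a ≠ 0 := by
    rintro rfl
    exact hz1 (by rw [ha, C_0])
  obtain rfl : z = a • q K := by
    refine ext_comp fun t => ?_
    rw [map_smul, comp_q]
    split_ifs with h
    · rw [← h, ha, smul_eq_C_mul, mul_one]
    · rw [smul_zero]
      rcases lt_or_ge t 1 with h1 | h1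
      · exact hz t h1
      · exact hz2 t (by omega)
  have hzmem : a • q K ∈ Algebra.adjoin K {a • q K, w} := Algebra.subset_adjoin (Or.inl rfl)
  have hwmem : w ∈ Algebra.adjoin K {a • q K, w} := Algebra.subset_adjoin (Or.inr rfl)
  have hq : q K ∈ Algebra.adjoin K {a • q K, w} := by
    have h := Subalgebra.smul_mem _ hzmem a⁻¹
    rwa [smul_smul, inv_mul_cancel₀ ha0, one_smul] at h
  have hc : q K * (a • w + p K) - (a • w + p K) * q K = 0 := by
    rw [smul_mul_assoc, mul_smul_comm] at hzw
    rw [mul_add, add_mul, mul_smul_comm, smul_mul_assoc, p_mul_q, ← hzw]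
    abel
  have hv : a • w + p K ∈ Algebra.adjoin K {a • q K, w} :=
    Algebra.adjoin_le (Set.singleton_subset_iff.2 hq) (mem_adjoin_q_of_commute hc)
  have hp : p K ∈ Algebra.adjoin K {a • q K, w} := by
    have h := sub_mem hv (Subalgebra.smul_mem _ hwmem a)
    rwa [add_sub_cancel_left] at h
  rw [eq_top_iff, ← adjoin_p_q]
  refine Algebra.adjoin_le ?_
  rintro x (rfl | rfl)
  · exact hp
  · exact hq

theorem adjoin_eq_top_of_mem_Dge_one {z w : WeylAlgebra K} (hzw : z * w - w * z = 1)
    (hz : ∀ s < 1, comp s z = 0) : Algebra.adjoin K {z, w} = ⊤ := by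
  have h1 : (1 : WeylAlgebra K) ≠ 0 := fun h => by
    simpa [comp_one] using congrArg (comp 0) h
  have hz0 : z ≠ 0 := by
    rintro rfl
    exact h1 (by rw [← hzw]; simp)
  have hw0 : w ≠ 0 := by
    rintro rfl
    exact h1 (by rw [← hzw]; simp)
  obtain ⟨s, hzs, hsmin⟩ := exists_lowest hz0
  obtain ⟨t, hwt, htmin⟩ := exists_lowest hw0
  -- If w started in degree t < -1, then n ≥ -t ≥ 2 and t m - s n < 0, contradicting m + n = 1.
  refine adjoin_eq_top_of_components hzw hz fun t' ht' => ?_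
  by_contra hne
  have ht : t < -1 := (not_lt.1 fun h => hne (htmin t' h)).trans_lt ht'
  have hs : 1 ≤ s := not_lt.1 fun h => hzs (hz s h)
  have hn := neg_le_natDegree_comp hwt
  have hd := degrees_of_commutator_eq_one_of_lowest hzw hzs hwt hsmin htmin (by
    have h2 : t * ((comp s z).natDegree : ℤ) ≤ 0 :=
      mul_nonpos_of_nonpos_of_nonneg (by omega) (by omega)
    have h3 : 0 < s * ((comp t w).natDegree : ℤ) := mul_pos (by omega) (by omega)
    omega)
  omega

theorem adjoin_eq_top_of_mem_Dge_zero {z w : WeylAlgebra K} (hzw : z * w - w * z = 1)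
    (hz : ∀ s < 0, comp s z = 0) : Algebra.adjoin K {z, w} = ⊤ := by
  have hw0 : w ≠ 0 := by
    rintro rfl
    simpa [comp_one] using congrArg (comp 0) hzw
  obtain ⟨t, hwt, htmin⟩ := exists_lowest hw0
  have ht : t < 0 := by
    -- Degree-0 components are polynomials in X and commute, so [z, w] would have no constant term.
    by_contra! ht
    have h := comp_commutator_lowest (s := 0) (t := 0) hz fun t' ht' => htmin t' (by omega)
    rw [hzw, add_zero, comp_one, if_pos rfl, bracket] at h
    simp [mul_comm] at h
  have hdz : (comp 0 z).natDegree = 0 := by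
    by_cases hz0 : comp 0 z = 0
    · simp [hz0]
    by_contra hd
    have h := degrees_of_commutator_eq_one_of_lowest hzw hz0 hwt hz htmin (by
      rw [zero_mul, sub_zero]
      exact mul_ne_zero ht.ne (by exact_mod_cast hd))
    omega
  obtain ⟨a, ha⟩ : ∃ a, comp 0 z = C a := ⟨_, eq_C_of_natDegree_eq_zero hdz⟩
  have hcomm : (z - algebraMap K _ a) * w - w * (z - algebraMap K _ a) = 1 := by
    rw [sub_mul, mul_sub, Algebra.commutes, sub_sub_sub_cancel_right, hzw]
  have h := adjoin_eq_top_of_mem_Dge_one hcomm (by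
    intro s hs
    rw [map_sub, Algebra.algebraMap_eq_smul_one, map_smul, comp_one]
    split_ifs with h0
    · rw [← h0, ha, smul_eq_C_mul, mul_one, sub_self]
    · rw [smul_zero, sub_zero]
      exact hz s (by omega))
  rw [eq_top_iff, ← h]
  refine Algebra.adjoin_le ?_
  rintro x (rfl | rfl)
  · exact sub_mem (Algebra.subset_adjoin (Or.inl rfl)) (Subalgebra.algebraMap_mem _ _)
  · exact Algebra.subset_adjoin (Or.inr rfl)

/-- If `z` has lowest degree `-1`, the component of degree `-k` of `w` is a multiple of that of
`z ^ k`. -/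
theorem exists_comp_sub_smul_pow_eq_zero {z w : WeylAlgebra K} (hzw : z * w - w * z = 1)
    (hz1 : comp (-1) z ≠ 0) (hz : ∀ s < -1, comp s z = 0) (k : ℕ)
    (hw : ∀ t < -(k : ℤ), comp t w = 0) :
    ∃ b : K, (z * (w - b • z ^ k) - (w - b • z ^ k) * z = 1) ∧
      ∀ t < -(k : ℤ) + 1, comp t (w - b • z ^ k) = 0 := by
  have hk : (k : ℤ) * -1 = -k := by ring
  obtain ⟨hu, hdu⟩ := comp_pow_lowest hz hz1 k
  have hu0 := comp_pow_eq_zero hz k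
  rw [hk] at hu hdu hu0
  have hcomm : ∀ b : K, z * (w - b • z ^ k) - (w - b • z ^ k) * z = 1 := by
    intro b
    rw [mul_sub, sub_mul, mul_smul_comm, smul_mul_assoc, ← pow_succ, ← pow_succ',
      sub_sub_sub_cancel_right, hzw]
  have hvan : ∀ b : K, ∀ t < -(k : ℤ), comp t (w - b • z ^ k) = 0 := by
    intro b t ht
    rw [map_sub, map_smul, hw t ht, hu0 t ht, smul_zero, sub_zero]
  -- The total degree -1 - k is not 0, so the leading term must cancel: t m = s n, that is n = k m,
  -- the degree of the component of z^k.
  have hdeg : ∀ y : WeylAlgebra K, z * y - y * z = 1 → (∀ t < -(k : ℤ), comp t y = 0) →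
      comp (-(k : ℤ)) y ≠ 0 → (comp (-(k : ℤ)) y).natDegree =
        (comp (-(k : ℤ)) (z ^ k)).natDegree := by
    intro y hzy hy hy0
    by_contra hne
    have h := degrees_of_commutator_eq_one_of_lowest hzy hz1 hy0 hz hy (by
      intro h0
      apply hne
      rw [hdu]
      zify
      linarith)
    omega
  -- This b cancels the leading coefficient; a nonzero remainder would still need the same degree,
  -- so the whole component vanishes.
  refine ⟨(comp (-(k : ℤ)) w).coeff (comp (-(k : ℤ)) (z ^ k)).natDegree /
    (comp (-(k : ℤ)) (z ^ k)).leadingCoeff, hcomm _, fun t ht => ?_⟩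
  rcases lt_or_eq_of_le (Int.lt_add_one_iff.1 ht) with ht | rfl
  · exact hvan _ t ht
  by_contra hne
  have h := hdeg _ (hcomm _) (hvan _) hne
  apply hne
  rw [← leadingCoeff_eq_zero, leadingCoeff, h, map_sub, map_smul, coeff_sub, coeff_smul,
    smul_eq_mul, coeff_natDegree, div_mul_cancel₀ _ (leadingCoeff_ne_zero.2 hu), sub_self]

theorem adjoin_eq_top_of_lowest_neg_one {z : WeylAlgebra K} (hz1 : comp (-1) z ≠ 0)
    (hz : ∀ s < -1, comp s z = 0) (k : ℕ) :
    ∀ w : WeylAlgebra K, z * w - w * z = 1 → (∀ t < -(k : ℤ), comp t w = 0) →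
      Algebra.adjoin K {z, w} = ⊤ := by
  induction k with
  | zero =>
    intro w hzw hw
    obtain ⟨b, hb, hb0⟩ := exists_comp_sub_smul_pow_eq_zero hzw hz1 hz 0 hw
    -- Now w - b lies in degrees ≥ 1, and [w - b, -z] = 1 lets the two elements exchange roles.
    have h := adjoin_eq_top_of_components (z := w - b • z ^ 0) (w := -z)
      (by rw [← hb, mul_neg, neg_mul]; abel) (by simpa using hb0)
      fun t ht => by rw [map_neg, hz t ht, neg_zero]
    rw [eq_top_iff, ← h]
    refine le_trans (Algebra.adjoin_le ?_) (adjoin_sub_smul_pow_le z w b 0)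
    rintro x (rfl | rfl)
    · exact Algebra.subset_adjoin (Or.inr rfl)
    · exact neg_mem (Algebra.subset_adjoin (Or.inl rfl))
  | succ k ih =>
    intro w hzw hw
    obtain ⟨b, hb, hb0⟩ := exists_comp_sub_smul_pow_eq_zero hzw hz1 hz (k + 1) hw
    rw [eq_top_iff, ← ih (w - b • z ^ (k + 1)) hb fun t ht => hb0 t (by push_cast; omega)]
    exact adjoin_sub_smul_pow_le z w b (k + 1)

end Generation

end WeylAlgebra

theorem corollary98 {K : Type*} [Field K] [CharZero K] (z w : WeylAlgebra K)
    (hzw : z * w - w * z = 1) (hz : z ∈ WeylAlgebra.Dge K (-1)) :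
    Algebra.adjoin K ({z, w} : Set (WeylAlgebra K)) = ⊤ := by
  have hz' : ∀ s < -1, WeylAlgebra.comp s z = 0 := fun s hs =>
    WeylAlgebra.comp_eq_zero_of_mem_Dge hz hs
  by_cases hz1 : WeylAlgebra.comp (-1) z = 0
  · refine WeylAlgebra.adjoin_eq_top_of_mem_Dge_zero hzw fun s hs => ?_
    rcases eq_or_lt_of_le (show s ≤ -1 by omega) with rfl | h
    · exact hz1
    · exact hz' s h
  · obtain ⟨k, hk⟩ := WeylAlgebra.exists_comp_eq_zero_of_lt w
    exact WeylAlgebra.adjoin_eq_top_of_lowest_neg_one hz1 hz' k w hzw hk
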